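/- For a monoid $M$ and $a,b\in M$ write $a\,\mathcal R\,b$ if $aM=bM$, write $a\,\mathcal L\,b$ if $Ma=Mb$, and write $a\,\mathcal H\,b$ if both $a\,\mathcal R\,b$ and $a\,\mathcal L\,b$ (Green's relations). Let $n\in\mathbb N$ and let $K$ be a field in which every polynomial in $K[X]$ of degree $n$ has a root. Regard the set $M_n(K)$ of $n\times n$ matrices over $K$ as a monoid under matrix multiplication and as a $K$-vector space, and let $T\colon M_n(K)\to M_n(K)$ be a $K$-linear map. Then $T$ preserves $\mathcal H$, that is, $A\,\mathcal H\,B$ implies $T(A)\,\mathcal H\,T(B)$ for all $A,B\in M_n(K)$, if and only if one of the following holds: - $T=0$; - there exist $P,Q\in GL_n(K)$ such that $T(A)=PAQ$ for all $A\in M_n(K)$; - there exist $P,Q\in GL_n(K)$ such that $T(A)=PA^{T}Q$ for all $A\in M_n(K)$. Here $A^{T}$ denotes the transpose of $A$. -/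

import Mathlib

namespace GreenRel

variable {M : Type*} [Monoid M]

/-- Green's pre-order `≤_R` on a monoid: `a = b * s` for some `s`. -/
def RLE (a b : M) : Prop := ∃ s : M, a = b * s

/-- Green's pre-order `≤_L` on a monoid: `a = s * b` for some `s`. -/
def LLE (a b : M) : Prop := ∃ s : M, a = s * b

/-- Green's relation `R`: `a` and `b` generate the same principal right ideal. -/
def R (a b : M) : Prop := RLE a b ∧ RLE b a

/-- Green's relation `L`: `a` and `b` generate the same principal left ideal. -/
def L (a b : M) : Prop := LLE a b ∧ LLE b a

/-- Green's relation `H`, the intersection of `R` and `L`. -/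
def H (a b : M) : Prop := R a b ∧ L a b

end GreenRel

/-- A map `f` (weakly) preserves the binary relation `r`. -/
def PreservesRel {X : Type*} (r : X → X → Prop) (f : X → X) : Prop :=
  ∀ a b : X, r a b → r (f a) (f b)

/-! All invertible matrices are `H`-related, so for invertible `A` the matrices `T A` and `T 1` have
the same kernel and range. Let `2 ≤ n`. If `T 1 *ᵥ v ≠ 0`, then `A ↦ T A *ᵥ v` vanishes on no
invertible matrix, so its kernel is a space of singular matrices of codimension at most `n`.
Dieudonné's theorem (`factorsThroughEval_or_transpose`) turns this map into `F (A *ᵥ x)` or `F (Aᵀ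
*ᵥ x)` with `F` injective and `x ≠ 0`. It is thus onto; since invertible matrices span, its values
lie in the range of `T 1`. Hence `T 1` is invertible and every `v ≠ 0` qualifies. The same type
occurs for all `v`, and comparing the maps at basis vectors yields `P` and `Q`.

Dieudonné's theorem rests on a dimension estimate: if a linear map into `U` vanishes on no
invertible matrix but kills the rank one map `φ ⊗ p`, then the rank one maps sharing `p` or `φ` have
images spanning a space of dimension at most `dim U - (n - 1)`, so at most a line when `dim U = n`.
An eigenvalue, from a root in degree `n`, supplies a killed rank one matrix. -/

open Module Matrix

/-! ### Linear maps that vanish on no injective map -/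

/-- The images under `Φ` of the rank one maps with range in `K ∙ p`, together with those of the
rank one maps with kernel containing `ker φ`. -/
def rankOneCross {K E E' U : Type*} [Field K] [AddCommGroup E] [Module K E]
    [AddCommGroup E'] [Module K E'] [AddCommGroup U] [Module K U]
    (Φ : (E →ₗ[K] E') →ₗ[K] U) (p : E') (φ : E →ₗ[K] K) : Submodule K U :=
  LinearMap.range (Φ ∘ₗ (LinearMap.smulRightₗ : (E →ₗ[K] K) →ₗ[K] E' →ₗ[K] E →ₗ[K] E').flip p) ⊔
    LinearMap.range (Φ ∘ₗ (LinearMap.smulRightₗ : (E →ₗ[K] K) →ₗ[K] E' →ₗ[K] E →ₗ[K] E') φ)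

section
variable {K : Type*} [Field K]

theorem mem_rankOneCross_left {E E' U : Type*} [AddCommGroup E] [Module K E]
    [AddCommGroup E'] [Module K E'] [AddCommGroup U] [Module K U]
    (Φ : (E →ₗ[K] E') →ₗ[K] U) (p : E') (φ α : E →ₗ[K] K) :
    Φ (α.smulRight p) ∈ rankOneCross Φ p φ :=
  Submodule.mem_sup_left ⟨α, rfl⟩

theorem mem_rankOneCross_right {E E' U : Type*} [AddCommGroup E] [Module K E]
    [AddCommGroup E'] [Module K E'] [AddCommGroup U] [Module K U]
    (Φ : (E →ₗ[K] E') →ₗ[K] U) (p q : E') (φ : E →ₗ[K] K) :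
    Φ (φ.smulRight q) ∈ rankOneCross Φ p φ :=
  Submodule.mem_sup_right ⟨q, rfl⟩

/-- If a linear map is injective modulo `p` on `ker φ`, then it becomes injective
after possibly adding the rank one map `φ ⊗ p`. -/
theorem injective_or_injective_add_smulRight {E E' : Type*} [AddCommGroup E] [Module K E]
    [AddCommGroup E'] [Module K E'] (B : E →ₗ[K] E') (p : E') (φ : E →ₗ[K] K)
    (h : ∀ k, φ k = 0 → ∀ c : K, B k = c • p → k = 0) (hp : p ≠ 0) :
    Function.Injective B ∨ Function.Injective (B + φ.smulRight p) := by
  by_contra hcon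
  push Not at hcon
  obtain ⟨h1, h2⟩ := hcon
  rw [← LinearMap.ker_eq_bot, ← ne_eq, Submodule.ne_bot_iff] at h1 h2
  obtain ⟨v, hv, hv0⟩ := h1
  obtain ⟨w, hw, hw0⟩ := h2
  rw [LinearMap.mem_ker] at hv hw
  have hφv : φ v ≠ 0 := fun h0 => hv0 (h v h0 0 (by simpa using hv))
  have hw' : B w = -(φ w • p) := by
    rw [LinearMap.add_apply] at hw
    exact eq_neg_of_add_eq_zero_left hw
  have hφw : φ w ≠ 0 := fun h0 => hw0 (h w h0 0 (by simp [hw', h0]))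
  -- This combination lies in `ker φ` and `B` sends it to a nonzero multiple of `p`.
  have hk := h (φ w • v - φ v • w) (by simp [mul_comm]) (φ v * φ w) (by
    simp [hv, hw', mul_smul])
  have hB : B (φ w • v - φ v • w) = (φ v * φ w) • p := by simp [hv, hw', mul_smul]
  rw [hk, map_zero] at hB
  rcases smul_eq_zero.1 hB.symm with h3 | h3
  · exact (mul_ne_zero hφv hφw) h3
  · exact hp h3

/-- Apply the case `n` to maps `ker φ → ker ψ`, with `ψ p = 1`, and to `U` modulo the cross. An
injective `M` killed there can be corrected by cross elements to a map in `ker Φ` that is still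
injective modulo `p` on `ker φ`. The case `n` is a premise so that the estimate serves inside the
induction as well as after it. -/
theorem add_finrank_rankOneCross_le_of_forall {E E' U : Type*} [AddCommGroup E] [Module K E]
    [AddCommGroup E'] [Module K E'] [AddCommGroup U] [Module K U]
    [FiniteDimensional K E] [FiniteDimensional K E'] [FiniteDimensional K U] {n : ℕ}
    (IH : ∀ (E₁ : Submodule K E) (E₁' : Submodule K E') (U₁ : Submodule K U)
      (Ψ : (E₁ →ₗ[K] E₁') →ₗ[K] U ⧸ U₁), finrank K E₁ = n → finrank K E₁' = n →
      (∀ A : E₁ →ₗ[K] E₁', Function.Injective A → Ψ A ≠ 0) → n ≤ finrank K (U ⧸ U₁))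
    (hE : finrank K E = n + 1) (hE' : finrank K E' = n + 1)
    (Φ : (E →ₗ[K] E') →ₗ[K] U) (hΦ : ∀ A : E →ₗ[K] E', Function.Injective A → Φ A ≠ 0)
    (p : E') (φ : E →ₗ[K] K) (hp : p ≠ 0) (hφ : φ ≠ 0) (h0 : Φ (φ.smulRight p) = 0) :
    n + finrank K (rankOneCross Φ p φ) ≤ finrank K U := by
  obtain ⟨ψ, hψ⟩ : ∃ ψ : E' →ₗ[K] K, ψ p = 1 :=
    Module.Projective.exists_dual_eq_one K hp
  obtain ⟨e, he⟩ : ∃ e, φ e = 1 := by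
    obtain ⟨x, hx⟩ := DFunLike.ne_iff.1 hφ
    exact ⟨(φ x)⁻¹ • x, by simpa using inv_mul_cancel₀ hx⟩
  have hψ0 : ψ ≠ 0 := by rintro rfl; simp at hψ
  have d1 : finrank K (LinearMap.ker φ) = n := by
    have := Module.Dual.finrank_ker_add_one_of_ne_zero (f := φ) hφ
    omega
  have d2 : finrank K (LinearMap.ker ψ) = n := by
    have := Module.Dual.finrank_ker_add_one_of_ne_zero (f := ψ) hψ0
    omega
  let π : E →ₗ[K] LinearMap.ker φ :=
    LinearMap.codRestrict _ (LinearMap.id - φ.smulRight e) (fun v => by simp [he])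
  have hπ : ∀ k : LinearMap.ker φ, π k = k := fun k => by
    apply Subtype.ext
    have := k.2
    rw [LinearMap.mem_ker] at this
    change (k : E) - φ k • e = k
    simp [this]
  let C := rankOneCross Φ p φ
  let lift : (LinearMap.ker φ →ₗ[K] LinearMap.ker ψ) →ₗ[K] (E →ₗ[K] E') :=
    { toFun := fun M => (LinearMap.ker ψ).subtype ∘ₗ M ∘ₗ π
      map_add' := fun a b => by ext; simp
      map_smul' := fun a b => by ext; simp }
  have key := IH (LinearMap.ker φ) (LinearMap.ker ψ) C (C.mkQ ∘ₗ Φ ∘ₗ lift) d1 d2 (by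
    intro M hM hz
    have hz' : Φ (lift M) ∈ C := by simpa using hz
    obtain ⟨_, ⟨α, rfl⟩, _, ⟨q, rfl⟩, hsum⟩ := Submodule.mem_sup.1 hz'
    set B : E →ₗ[K] E' := lift M - α.smulRight p - φ.smulRight q with hB
    have hΦB : Φ B = 0 := by
      rw [hB, map_sub, map_sub, ← hsum]
      simp [LinearMap.smulRightₗ]
    have hk : ∀ k, φ k = 0 → ∀ c : K, B k = c • p → k = 0 := by
      intro k hk c hc
      have h1 : B k = (M ⟨k, hk⟩ : E') - α k • p := by
        have := hπ ⟨k, hk⟩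
        simp only at this
        simp [hB, lift, hk, this]
      rw [h1] at hc
      have h2 : ψ (M ⟨k, hk⟩ : E') = 0 := (M ⟨k, hk⟩).2
      have h3 := congrArg ψ hc
      simp only [map_sub, map_smul, h2, hψ, smul_eq_mul, mul_one, zero_sub] at h3
      rw [← h3, neg_smul, sub_eq_neg_self] at hc
      have := hM (a₁ := ⟨k, hk⟩) (a₂ := 0) (by rw [map_zero]; exact Subtype.ext hc)
      exact congrArg Subtype.val this
    -- Both candidates lie in `ker Φ`, because `Φ` kills `φ ⊗ p`.
    rcases injective_or_injective_add_smulRight B p φ hk hp with h | h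
    · exact hΦ _ h hΦB
    · exact hΦ _ h (by rw [map_add, hΦB, h0, add_zero]))
  have := Submodule.finrank_quotient_add_finrank C
  change n + finrank K C ≤ _
  omega

/-- If `dim U` were smaller, every `p ≠ 0` would have some killed `φ ⊗ p` with `φ ≠ 0`. The estimate
then makes the cross zero, so `Φ` kills all rank one maps, and hence an isomorphism. -/
theorem le_finrank_of_forall_injective (n : ℕ) : ∀ {E E' U : Type*} [AddCommGroup E] [Module K E]
    [AddCommGroup E'] [Module K E'] [AddCommGroup U] [Module K U]
    [FiniteDimensional K E] [FiniteDimensional K E'] [FiniteDimensional K U],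
    finrank K E = n → finrank K E' = n → ∀ (Φ : (E →ₗ[K] E') →ₗ[K] U),
    (∀ A : E →ₗ[K] E', Function.Injective A → Φ A ≠ 0) → n ≤ finrank K U := by
  induction n with
  | zero => intros; exact Nat.zero_le _
  | succ n IH =>
    intro E E' U _ _ _ _ _ _ _ _ _ hE hE' Φ hΦ
    by_contra hlt
    have step := add_finrank_rankOneCross_le_of_forall (n := n)
      (fun E₁ E₁' U₁ Ψ h1 h2 h3 => IH h1 h2 Ψ h3) hE hE' Φ hΦ
    have hzero : ∀ (p : E') (α : E →ₗ[K] K), Φ (α.smulRight p) = 0 := by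
      intro p α
      rcases eq_or_ne p 0 with rfl | hp
      · simp
      let f : (E →ₗ[K] K) →ₗ[K] U := Φ ∘ₗ (LinearMap.smulRightₗ :
        (E →ₗ[K] K) →ₗ[K] E' →ₗ[K] E →ₗ[K] E').flip p
      have hker : LinearMap.ker f ≠ ⊥ := by
        apply LinearMap.ker_ne_bot_of_finrank_lt
        change _ < finrank K (Module.Dual K E)
        rw [Subspace.dual_finrank_eq]; omega
      obtain ⟨φ, hφ, hφ0⟩ := (Submodule.ne_bot_iff _).1 hker
      have := step p φ hp hφ0 hφ
      have hC : finrank K (rankOneCross Φ p φ) = 0 := by omega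
      have hm := mem_rankOneCross_left Φ p φ α
      rw [Submodule.finrank_eq_zero.1 hC] at hm
      exact (Submodule.mem_bot K).1 hm
    let ι : E ≃ₗ[K] E' := LinearEquiv.ofFinrankEq E E' (hE.trans hE'.symm)
    refine hΦ ι.toLinearMap ι.injective ?_
    let b := Module.finBasis K E
    have : ι.toLinearMap = ∑ i, (b.coord i).smulRight (ι (b i)) := by
      ext v
      simp only [LinearEquiv.coe_coe, LinearMap.sum_apply, LinearMap.smulRight_apply,
        Basis.coord_apply, ← map_smul, ← map_sum, b.sum_repr]
    rw [this, map_sum]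
    exact Finset.sum_eq_zero fun i _ => hzero _ _

theorem add_finrank_rankOneCross_le {E E' U : Type*} [AddCommGroup E] [Module K E]
    [AddCommGroup E'] [Module K E'] [AddCommGroup U] [Module K U]
    [FiniteDimensional K E] [FiniteDimensional K E'] [FiniteDimensional K U] {n : ℕ}
    (hE : finrank K E = n + 1) (hE' : finrank K E' = n + 1)
    (Φ : (E →ₗ[K] E') →ₗ[K] U) (hΦ : ∀ A : E →ₗ[K] E', Function.Injective A → Φ A ≠ 0)
    (p : E') (φ : E →ₗ[K] K) (hp : p ≠ 0) (hφ : φ ≠ 0) (h0 : Φ (φ.smulRight p) = 0) :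
    n + finrank K (rankOneCross Φ p φ) ≤ finrank K U :=
  add_finrank_rankOneCross_le_of_forall
    (fun _ _ _ Ψ h1 h2 h3 => le_finrank_of_forall_injective n h1 h2 Ψ h3) hE hE' Φ hΦ p φ hp hφ h0

end

/-! ### Matrix forms of the estimates, and eigenvalues of pencils -/

section
variable {K : Type*} [Field K] {n : ℕ}

theorem le_finrank_of_forall_isUnit {U : Type*} [AddCommGroup U] [Module K U]
    [FiniteDimensional K U] (Φ : Matrix (Fin n) (Fin n) K →ₗ[K] U)
    (hΦ : ∀ A, IsUnit A → Φ A ≠ 0) : n ≤ finrank K U := by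
  refine le_finrank_of_forall_injective (E := Fin n → K) (E' := Fin n → K) n (by simp) (by simp)
    (Φ ∘ₗ LinearMap.toMatrix'.toLinearMap) fun A hA => hΦ _ ?_
  rw [← Matrix.mulVec_injective_iff_isUnit]
  intro v w h
  apply hA
  simpa using h

theorem exists_smul_of_vecMulVec_eq_zero (Φ : Matrix (Fin n) (Fin n) K →ₗ[K] (Fin n → K))
    (hΦ : ∀ A, IsUnit A → Φ A ≠ 0) (p φ : Fin n → K) (hp : p ≠ 0) (hφ : φ ≠ 0)
    (h0 : Φ (vecMulVec p φ) = 0) :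
    ∃ u, (∀ α, ∃ c : K, c • u = Φ (vecMulVec p α)) ∧
      ∀ q, ∃ c : K, c • u = Φ (vecMulVec q φ) := by
  obtain _ | m := n
  · exact absurd (Subsingleton.elim _ _) hp
  set Ψ : ((Fin (m + 1) → K) →ₗ[K] (Fin (m + 1) → K)) →ₗ[K] (Fin (m + 1) → K) :=
    Φ ∘ₗ LinearMap.toMatrix'.toLinearMap with hΨ
  have hv : ∀ q α, Ψ ((dotProductEquiv K (Fin (m + 1)) α).smulRight q) = Φ (vecMulVec q α) := by
    intro q α
    simp only [hΨ, LinearMap.comp_apply]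
    congr 1
    ext i j
    simp [LinearMap.toMatrix'_apply, vecMulVec_apply, mul_comm]
  have := add_finrank_rankOneCross_le (n := m) (by simp) (by simp) Ψ (fun A hA => hΦ _ (by
    rw [← Matrix.mulVec_injective_iff_isUnit]
    intro v w h
    apply hA
    simpa using h)) p (dotProductEquiv K (Fin (m + 1)) φ) hp (by simpa using hφ)
    (by rw [hv, h0])
  have h1 : finrank K (rankOneCross Ψ p (dotProductEquiv K (Fin (m + 1)) φ)) ≤ 1 := by
    rw [finrank_fin_fun] at this; omega
  obtain ⟨u, hu⟩ := finrank_le_one_iff.1 h1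
  refine ⟨u, fun α => ?_, fun q => ?_⟩
  · obtain ⟨c, hc⟩ := hu ⟨_, mem_rankOneCross_left Ψ p _ (dotProductEquiv K _ α)⟩
    exact ⟨c, by rw [← hv]; exact congrArg Subtype.val hc⟩
  · obtain ⟨c, hc⟩ := hu ⟨_, mem_rankOneCross_right Ψ p q _⟩
    exact ⟨c, by rw [← hv]; exact congrArg Subtype.val hc⟩

theorem linearMap_ext_vecMulVec {U : Type*} [AddCommGroup U] [Module K U]
    {Φ Ψ : Matrix (Fin n) (Fin n) K →ₗ[K] U}
    (h : ∀ p q, Φ (vecMulVec p q) = Ψ (vecMulVec p q)) : Φ = Ψ := by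
  refine Matrix.ext_linearMap _ fun i j => ?_
  ext
  have := h (Pi.single i 1) (Pi.single j 1)
  simpa [single_eq_single_vecMulVec_single] using this

/-- The linear pencil `F - λ G` of square matrices has a nonzero kernel for some `λ`,
when `G` is injective. -/
theorem exists_apply_eq_smul_apply
    (hK : ∀ p : Polynomial K, p.degree = (n : WithBot ℕ) → ∃ x : K, p.IsRoot x)
    (F G : (Fin n → K) →ₗ[K] (Fin n → K)) (hG : Function.Injective G) :
    ∃ (c : K) (y : Fin n → K), y ≠ 0 ∧ F y = c • G y := by
  let e := LinearEquiv.ofInjectiveEndo G hG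
  let f : End K (Fin n → K) := e.symm.toLinearMap ∘ₗ F
  obtain ⟨c, hc⟩ := hK f.charpoly (by
    rw [Polynomial.degree_eq_natDegree f.charpoly_monic.ne_zero, LinearMap.charpoly_natDegree]
    simp)
  obtain ⟨y, hy⟩ := ((End.hasEigenvalue_iff_isRoot_charpoly f c).2 hc).exists_hasEigenvector
  refine ⟨c, y, hy.2, ?_⟩
  have h := congrArg e hy.apply_eq_smul
  simpa [f, e] using h

end

/-! ### Factoring through evaluation at a vector -/

section
variable {K : Type*} [Field K] {n : ℕ}

theorem exists_eq_smul_of_smul_eq {U : Type*} [AddCommGroup U] [Module K U] {u w z : U} {a b : K}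
    (hw : w ≠ 0) (ha : a • u = w) (hb : b • u = z) : ∃ c : K, z = c • w := by
  have ha0 : a ≠ 0 := by rintro rfl; exact hw (by simpa using ha.symm)
  exact ⟨b * a⁻¹, by rw [← ha, ← hb, smul_smul, mul_assoc, inv_mul_cancel₀ ha0, mul_one]⟩

theorem det_ne_zero_of_dual_apply (f : (Fin 2 → K) →ₗ[K] K) {p q : Fin 2 → K} (hp : p ≠ 0)
    (hfp : f p = 0) (hfq : f q = 1) : p 0 * q 1 - p 1 * q 0 ≠ 0 := by
  intro h
  have hf : ∀ v : Fin 2 → K, f v = v 0 * f (Pi.single 0 1) + v 1 * f (Pi.single 1 1) := by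
    intro v
    conv_lhs => rw [pi_eq_sum_univ' v]
    simp [Fin.sum_univ_two, map_add, map_smul]
  rw [hf] at hfp hfq
  apply hp
  ext i
  fin_cases i
  · simp only [Fin.zero_eta, Pi.zero_apply]
    linear_combination (-p 0) * hfq + f (Pi.single 1 1) * h + q 0 * hfp
  · simp only [Fin.mk_one, Pi.zero_apply]
    linear_combination (-p 1) * hfq - f (Pi.single 0 1) * h + q 1 * hfp

/-- If `Φ` vanishes on no invertible matrix, and `Φ (p ⊗ ·)` is neither zero nor injective for
some `p`, then `Φ` factors through the evaluation at a vector. -/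
theorem exists_eq_apply_mulVec (hn : 2 ≤ n) (Φ : Matrix (Fin n) (Fin n) K →ₗ[K] (Fin n → K))
    (hΦ : ∀ A, IsUnit A → Φ A ≠ 0) (p φ α : Fin n → K) (hp : p ≠ 0) (hφ : φ ≠ 0)
    (h0 : Φ (vecMulVec p φ) = 0) (hα : Φ (vecMulVec p α) ≠ 0) :
    ∃ (F : (Fin n → K) →ₗ[K] (Fin n → K)) (x : Fin n → K), ∀ A, Φ A = F (A *ᵥ x) := by
  let B : (Fin n → K) →ₗ[K] (Fin n → K) →ₗ[K] (Fin n → K) := (vecMulVecBilin K K).compr₂ Φ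
  have hB : ∀ q α, B q α = Φ (vecMulVec q α) := fun _ _ => rfl
  have hS : ∀ p φ, p ≠ 0 → φ ≠ 0 → B p φ = 0 → ∃ u, (∀ α, ∃ c : K, c • u = B p α) ∧
      ∀ q, ∃ c : K, c • u = B q φ := exists_smul_of_vecMulVec_eq_zero Φ hΦ
  simp only [← hB] at h0 hα
  set w := B p α with hw
  obtain ⟨τ, hτ⟩ := Module.Projective.exists_dual_eq_one K hα
  let g : (Fin n → K) →ₗ[K] K := τ ∘ₗ B p
  have hg : ∀ φ', B p φ' = g φ' • w := by
    obtain ⟨u, hu, -⟩ := hS p φ hp hφ h0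
    intro φ'
    obtain ⟨a, ha⟩ := hu α
    obtain ⟨b, hb⟩ := hu φ'
    obtain ⟨c, hc⟩ := exists_eq_smul_of_smul_eq hα ha hb
    simp [g, hc, hτ]
  have hgα : g α = 1 := hτ
  have hcross : ∀ φ', g φ' = 0 → ∀ q, ∃ c : K, B q φ' = c • w := by
    intro φ' hφ' q
    rcases eq_or_ne φ' 0 with rfl | hne
    · exact ⟨0, by simp⟩
    obtain ⟨u, hu, hu'⟩ := hS p φ' hp hne (by rw [hg, hφ', zero_smul])
    obtain ⟨a, ha⟩ := hu α
    obtain ⟨b, hb⟩ := hu' q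
    exact exists_eq_smul_of_smul_eq hα ha hb
  -- Otherwise the image of `Φ` is spanned by two vectors, which forces `n = 2`, and an explicit
  -- invertible matrix is killed.
  have hvan : ∀ φ', g φ' = 0 → ∀ q, B q φ' = 0 := by
    intro φ₀ hφ₀
    by_contra! hcon
    obtain ⟨q₀, hq₀⟩ := hcon
    have hφ₀ne : φ₀ ≠ 0 := by rintro rfl; simp at hq₀
    let f : (Fin n → K) →ₗ[K] K := τ ∘ₗ B.flip φ₀
    have hf : ∀ q, B q φ₀ = f q • w := by
      intro q
      obtain ⟨c, hc⟩ := hcross φ₀ hφ₀ q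
      simp [f, hc, hτ]
    have hfq₀ : f q₀ ≠ 0 := by intro h; rw [hf, h, zero_smul] at hq₀; exact hq₀ rfl
    have hcross' : ∀ q, f q = 0 → ∀ φ', ∃ c : K, B q φ' = c • w := by
      intro q hq φ'
      rcases eq_or_ne q 0 with rfl | hne
      · exact ⟨0, by simp⟩
      obtain ⟨u, hu, hu'⟩ := hS q φ₀ hne hφ₀ne (by rw [hf, hq, zero_smul])
      obtain ⟨a, ha⟩ := hu φ'
      obtain ⟨b, hb⟩ := hu' q₀
      obtain ⟨c, hc⟩ := exists_eq_smul_of_smul_eq hq₀ hb ha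
      exact ⟨c * f q₀, by rw [hc, hf q₀, smul_smul]⟩
    obtain ⟨q₁, hq₁⟩ : ∃ q₁, f q₁ = 1 := ⟨(f q₀)⁻¹ • q₀, by simpa using inv_mul_cancel₀ hfq₀⟩
    let S : Submodule K (Fin n → K) := Submodule.span K (Set.range ![w, B q₁ α])
    have hwS : w ∈ S := Submodule.subset_span ⟨0, rfl⟩
    have hw2S : B q₁ α ∈ S := Submodule.subset_span ⟨1, rfl⟩
    have hBS : ∀ q φ', B q φ' ∈ S := by
      intro q φ'
      -- Splitting `q` along `ker f` and `q₁`, and `φ'` along `ker g` and `α`, leaves `B q₁ α` as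
      -- the only term outside the line of `w`.
      have e : B q φ' = B (q - f q • q₁) φ' + f q • B q₁ (φ' - g φ' • α)
          + (f q * g φ') • B q₁ α := by
        simp only [map_sub, map_smul, LinearMap.sub_apply, LinearMap.smul_apply, smul_sub,
          smul_smul]
        abel
      obtain ⟨a, ha⟩ := hcross' (q - f q • q₁) (by simp [hq₁]) φ'
      obtain ⟨b, hb⟩ := hcross (φ' - g φ' • α) (by simp [hgα]) q₁
      rw [e, ha, hb]
      exact S.add_mem (S.add_mem (S.smul_mem _ hwS) (S.smul_mem _ (S.smul_mem _ hwS)))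
        (S.smul_mem _ hw2S)
    have hΦS : ∀ A, Φ A ∈ S := by
      have : S.mkQ ∘ₗ Φ = 0 := linearMap_ext_vecMulVec fun q φ' => by
        simpa [hB] using hBS q φ'
      intro A
      simpa using LinearMap.congr_fun this A
    have hn2 : n ≤ finrank K S := le_finrank_of_forall_isUnit (Φ.codRestrict S hΦS)
      fun A hA h => hΦ A hA (congrArg Subtype.val h)
    have hS2 : finrank K S ≤ 2 := by
      exact finrank_range_le_card (R := K) ![w, B q₁ α]
    obtain rfl : n = 2 := by omega
    have hfp : f p = 0 := by
      change τ (B p φ₀) = 0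
      rw [hg, hφ₀, zero_smul, map_zero]
    -- Both terms are sent to `w`. The pairs `p, q₁` and `φ₀, α` are bases of the plane, separated
    -- by `f` and `g`.
    refine hΦ (vecMulVec p α - vecMulVec q₁ φ₀) ?_ ?_
    · rw [Matrix.isUnit_iff_isUnit_det, isUnit_iff_ne_zero]
      have h1 := det_ne_zero_of_dual_apply f hp hfp hq₁
      have h2 := det_ne_zero_of_dual_apply g hφ₀ne hφ₀ hgα
      convert mul_ne_zero h1 h2 using 1
      simp [Matrix.det_fin_two, vecMulVec_apply]
      ring
    · rw [map_sub, ← hB, ← hB, hf, hq₁, one_smul, sub_self]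
  -- Now `B q φ' = g φ' • B q α`, and the vector `x` represents `g` under the dot product.
  refine ⟨B.flip α, fun i => g (Pi.single i 1), fun A => ?_⟩
  suffices Φ = B.flip α ∘ₗ (Matrix.mulVecBilin K K).flip (fun i => g (Pi.single i 1)) from
    LinearMap.congr_fun this A
  refine linearMap_ext_vecMulVec fun q φ' => ?_
  have hx : φ' ⬝ᵥ (fun i => g (Pi.single i 1)) = g φ' := by
    conv_rhs => rw [pi_eq_sum_univ' φ']
    simp [dotProduct]
  have h1 := hvan (φ' - g φ' • α) (by simp [hgα]) q
  rw [map_sub, map_smul, sub_eq_zero] at h1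
  simp [vecMulVec_mulVec, hx, ← hB, h1]

end

/-! ### Dieudonné's theorem -/

section
variable {K : Type*} [Field K] {n : ℕ}

/-- The map `Φ` is the evaluation at a nonzero vector followed by an injective linear map. -/
def FactorsThroughEval (Φ : Matrix (Fin n) (Fin n) K →ₗ[K] (Fin n → K)) : Prop :=
  ∃ (F : (Fin n → K) →ₗ[K] (Fin n → K)) (x : Fin n → K),
    Function.Injective F ∧ x ≠ 0 ∧ ∀ A, Φ A = F (A *ᵥ x)

/-- The range of `F` contains all values of `Φ`, so the dimension bound makes it everything. -/
theorem FactorsThroughEval.of_eq {Φ : Matrix (Fin n) (Fin n) K →ₗ[K] (Fin n → K)}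
    (hΦ : ∀ A, IsUnit A → Φ A ≠ 0) {F : (Fin n → K) →ₗ[K] (Fin n → K)} {x : Fin n → K}
    (h : ∀ A, Φ A = F (A *ᵥ x)) : FactorsThroughEval Φ := by
  refine ⟨F, x, ?_, ?_, h⟩
  · have h1 : n ≤ finrank K (LinearMap.range F) :=
      le_finrank_of_forall_isUnit (Φ.codRestrict (LinearMap.range F) fun A => ⟨_, (h A).symm⟩)
        fun A hA h => hΦ A hA (congrArg Subtype.val h)
    have h2 : LinearMap.range F = ⊤ := by
      apply Submodule.eq_top_of_finrank_eq
      have := Submodule.finrank_le (LinearMap.range F)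
      simp only [finrank_fin_fun] at this ⊢
      omega
    exact LinearMap.injective_iff_surjective.2 (LinearMap.range_eq_top.1 h2)
  · rintro rfl
    exact hΦ 1 isUnit_one (by simp [h])

/-- Dieudonné's description of the linear spaces of singular matrices of the largest possible
dimension, over a field in which `n × n` matrices have eigenvalues. -/
theorem factorsThroughEval_or_transpose (hn : 2 ≤ n)
    (hK : ∀ p : Polynomial K, p.degree = (n : WithBot ℕ) → ∃ x : K, p.IsRoot x)
    (Φ : Matrix (Fin n) (Fin n) K →ₗ[K] (Fin n → K)) (hΦ : ∀ A, IsUnit A → Φ A ≠ 0) :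
    FactorsThroughEval Φ ∨
      FactorsThroughEval (Φ ∘ₗ (transposeLinearEquiv (Fin n) (Fin n) K K).toLinearMap) := by
  have hΦ' : ∀ A, IsUnit A →
      (Φ ∘ₗ (transposeLinearEquiv (Fin n) (Fin n) K K).toLinearMap) A ≠ 0 :=
    fun A hA => hΦ _ ((isUnit_transpose A).2 hA)
  have hΦt : ∀ p q, (Φ ∘ₗ (transposeLinearEquiv (Fin n) (Fin n) K K).toLinearMap)
      (vecMulVec p q) = Φ (vecMulVec q p) := by
    intro p q
    simp [transpose_vecMulVec]
  by_cases h1 : ∃ p φ α : Fin n → K, p ≠ 0 ∧ φ ≠ 0 ∧ Φ (vecMulVec p φ) = 0 ∧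
      Φ (vecMulVec p α) ≠ 0
  · obtain ⟨p, φ, α, hp, hφ, h0, hα⟩ := h1
    obtain ⟨F, x, h⟩ := exists_eq_apply_mulVec hn Φ hΦ p φ α hp hφ h0 hα
    exact Or.inl (.of_eq hΦ h)
  by_cases h2 : ∃ p φ q : Fin n → K, p ≠ 0 ∧ φ ≠ 0 ∧ Φ (vecMulVec p φ) = 0 ∧
      Φ (vecMulVec q φ) ≠ 0
  · obtain ⟨p, φ, q, hp, hφ, h0, hq⟩ := h2
    obtain ⟨F, x, h⟩ := exists_eq_apply_mulVec hn _ hΦ' φ p q hφ hp (by rwa [hΦt])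
      (by rwa [hΦt])
    exact Or.inr (.of_eq hΦ' h)
  -- In the remaining case a killed rank one matrix spreads along its row and column directions, so
  -- a single one forces `Φ = 0`.
  exfalso
  push Not at h1 h2
  obtain ⟨p₀, φ₀, hp₀, hφ₀, h0⟩ : ∃ p φ : Fin n → K, p ≠ 0 ∧ φ ≠ 0 ∧ Φ (vecMulVec p φ) = 0 := by
    let B : (Fin n → K) →ₗ[K] (Fin n → K) →ₗ[K] (Fin n → K) := (vecMulVecBilin K K).compr₂ Φ
    let i : Fin n := ⟨0, by omega⟩
    let j : Fin n := ⟨1, by omega⟩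
    have hij : i ≠ j := by simp [i, j]
    by_cases hG : Function.Injective (B (Pi.single j 1))
    · obtain ⟨c, y, hy, hc⟩ := exists_apply_eq_smul_apply hK (B (Pi.single i 1)) _ hG
      refine ⟨Pi.single i 1 - c • Pi.single j 1, y, fun h => ?_, hy, ?_⟩
      · simpa [hij] using congrFun h i
      · change B _ y = 0
        rw [map_sub, map_smul, LinearMap.sub_apply, LinearMap.smul_apply, hc, sub_self]
    · rw [← LinearMap.ker_eq_bot, ← ne_eq, Submodule.ne_bot_iff] at hG
      obtain ⟨φ, hφ, hφ0⟩ := hG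
      exact ⟨Pi.single j 1, φ, by simp, hφ0, hφ⟩
  have : Φ = 0 := linearMap_ext_vecMulVec fun q φ => by
    rcases eq_or_ne φ 0 with rfl | hφ
    · simp
    · simpa using h2 p₀ φ q hp₀ hφ (h1 p₀ φ₀ φ hp₀ hφ₀ h0)
  exact hΦ 1 isUnit_one (by simp [this])

theorem exists_eq_smul_of_dotProduct_eq_zero {x y : Fin n → K} (hy : y ≠ 0)
    (h : ∀ q, q ⬝ᵥ y = 0 → q ⬝ᵥ x = 0) : ∃ c : K, x = c • y := by
  obtain ⟨k, hk⟩ := Function.ne_iff.1 hy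
  refine ⟨x k / y k, ?_⟩
  ext l
  have := h (y k • Pi.single l 1 - y l • Pi.single k 1) (by
    simp [sub_dotProduct, smul_dotProduct, mul_comm])
  simp only [sub_dotProduct, smul_dotProduct, single_dotProduct, one_mul, smul_eq_mul] at this
  have hk' : y k ≠ 0 := hk
  simp only [Pi.smul_apply, smul_eq_mul]
  field_simp
  linear_combination this

theorem exists_dotProduct_ne_zero {y : Fin n → K} (hy : y ≠ 0) : ∃ q, q ⬝ᵥ y ≠ 0 := by
  obtain ⟨k, hk⟩ := Function.ne_iff.1 hy
  exact ⟨Pi.single k 1, by simpa using hk⟩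

/-- Take nonzero `p ⊥ y` and `q ⊥ z`, which needs `2 ≤ n`: the identity gives `q ⊥ x`, and a second
`p'` not orthogonal to `y` then forces `G q = 0`. -/
theorem not_forall_smul_add_smul_eq_smul (hn : 2 ≤ n)
    {F G H : (Fin n → K) →ₗ[K] (Fin n → K)} {x y z : Fin n → K} (hF : Function.Injective F)
    (hG : Function.Injective G) (hy : y ≠ 0) :
    ¬ ∀ p q, (q ⬝ᵥ x) • F p + (p ⬝ᵥ y) • G q = (q ⬝ᵥ z) • H p := by
  intro h
  have : Nontrivial (Fin n) := Fin.nontrivial_iff_two_le.2 hn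
  obtain ⟨p, hp, hpy⟩ := exists_ne_zero_dotProduct_eq_zero y
  obtain ⟨q, hq, hqz⟩ := exists_ne_zero_dotProduct_eq_zero z
  have hFp : F p ≠ 0 := fun h => hp (hF (by rw [h, map_zero]))
  have hGq : G q ≠ 0 := fun h => hq (hG (by rw [h, map_zero]))
  have hqx : q ⬝ᵥ x = 0 := by
    simpa [hpy, hqz, hFp] using h p q
  obtain ⟨p', hp'⟩ := exists_dotProduct_ne_zero hy
  exact smul_ne_zero hp' hGq (by simpa [hqx, hqz] using h p' q)

end

/-! ### Gluing the evaluations into one matrix formula -/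

section
variable {K : Type*} [Field K] {n : ℕ}

/-- The linear map `A ↦ T A *ᵥ v`. -/
def evalAt (T : Matrix (Fin n) (Fin n) K →ₗ[K] Matrix (Fin n) (Fin n) K) (v : Fin n → K) :
    Matrix (Fin n) (Fin n) K →ₗ[K] (Fin n → K) :=
  (mulVecBilin K K).flip v ∘ₗ T

@[simp]
theorem evalAt_apply (T : Matrix (Fin n) (Fin n) K →ₗ[K] Matrix (Fin n) (Fin n) K)
    (v : Fin n → K) (A : Matrix (Fin n) (Fin n) K) : evalAt T v A = T A *ᵥ v := rfl

/-- Precomposition of `T` with transposition. -/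
def compTranspose (T : Matrix (Fin n) (Fin n) K →ₗ[K] Matrix (Fin n) (Fin n) K) :
    Matrix (Fin n) (Fin n) K →ₗ[K] Matrix (Fin n) (Fin n) K :=
  T ∘ₗ (transposeLinearEquiv (Fin n) (Fin n) K K).toLinearMap

@[simp]
theorem compTranspose_apply (T : Matrix (Fin n) (Fin n) K →ₗ[K] Matrix (Fin n) (Fin n) K)
    (A : Matrix (Fin n) (Fin n) K) : compTranspose T A = T Aᵀ := rfl

/-- The `i`-th column of `T A` is `F i (A *ᵥ x i)`. Evaluating at combinations of two basis vectors
shows that the `x i` are pairwise non-parallel and the `F i` proportional, so one `F` gives `P` and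
the rescaled `x i` are the columns of `Q`. -/
theorem exists_eq_mul_mul_of_factorsThroughEval (hn : 2 ≤ n)
    (hK : ∀ p : Polynomial K, p.degree = (n : WithBot ℕ) → ∃ x : K, p.IsRoot x)
    (T : Matrix (Fin n) (Fin n) K →ₗ[K] Matrix (Fin n) (Fin n) K) (hT : IsUnit (T 1))
    (h : ∀ v, v ≠ 0 → FactorsThroughEval (evalAt T v)) :
    ∃ P Q : GeneralLinearGroup (Fin n) K, ∀ A, T A = (P : Matrix (Fin n) (Fin n) K) * A *
      (Q : Matrix (Fin n) (Fin n) K) := by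
  choose F x hF hx hTv using fun i : Fin n => h (Pi.single i 1) (by simp)
  have hrank : ∀ i p q, T (vecMulVec p q) *ᵥ Pi.single i 1 = (q ⬝ᵥ x i) • F i p := by
    intro i p q
    have := hTv i (vecMulVec p q)
    simpa [vecMulVec_mulVec] using this
  have hpar : ∀ i j, i ≠ j → ∀ c : K, x i ≠ c • x j := by
    intro i j hij c hc
    -- With parallel `x i` and `x j`, this `y` makes evaluation at `e_i - d e_j` kill every
    -- `vecMulVec y q`, which the injective `G` forbids.
    obtain ⟨d, y, hy, hd⟩ := exists_apply_eq_smul_apply hK (c • F i) (F j) (hF j)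
    obtain ⟨G, z, hG, hz, hGz⟩ := h (Pi.single i 1 - d • Pi.single j 1) (fun h0 => by
      simpa [hij] using congrFun h0 i)
    obtain ⟨q, hq⟩ := exists_dotProduct_ne_zero hz
    have h1 := hGz (vecMulVec y q)
    rw [evalAt_apply, mulVec_sub, mulVec_smul, hrank, hrank, hc, dotProduct_smul,
      smul_comm d, ← hd, smul_eq_mul, mul_comm, mul_smul, ← LinearMap.smul_apply,
      sub_self] at h1
    have h2 : (q ⬝ᵥ z) • G y = 0 := by simpa [vecMulVec_mulVec] using h1.symm
    rcases smul_eq_zero.1 h2 with h3 | h3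
    · exact hq h3
    · exact hy (hG (by rw [h3, map_zero]))
  have hsep : ∀ i j, i ≠ j → ∃ q, q ⬝ᵥ x j = 0 ∧ q ⬝ᵥ x i ≠ 0 := by
    intro i j hij
    by_contra! hcon
    obtain ⟨c, hc⟩ := exists_eq_smul_of_dotProduct_eq_zero (hx j) hcon
    exact hpar i j hij c hc
  have hprop : ∀ i j, i ≠ j → ∃ c : K, F i = c • F j := by
    intro i j hij
    obtain ⟨G, z, hG, hz, hGz⟩ := h (Pi.single i 1 + Pi.single j 1) (fun h0 => by
      simpa [hij] using congrFun h0 i)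
    have hadd : ∀ p q, (q ⬝ᵥ x i) • F i p + (q ⬝ᵥ x j) • F j p = (q ⬝ᵥ z) • G p := by
      intro p q
      have := hGz (vecMulVec p q)
      rw [evalAt_apply, mulVec_add, hrank, hrank] at this
      simpa [vecMulVec_mulVec] using this
    obtain ⟨q₁, h1, h1'⟩ := hsep i j hij
    obtain ⟨q₂, h2, h2'⟩ := hsep j i hij.symm
    have e1 : ∀ p, (q₁ ⬝ᵥ x i) • F i p = (q₁ ⬝ᵥ z) • G p := fun p => by
      simpa [h1] using hadd p q₁
    have e2 : ∀ p, (q₂ ⬝ᵥ x j) • F j p = (q₂ ⬝ᵥ z) • G p := fun p => by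
      simpa [h2] using hadd p q₂
    have hne : q₂ ⬝ᵥ z ≠ 0 := by
      intro h0
      have := e2 (Pi.single i 1)
      rw [h0, zero_smul] at this
      rcases smul_eq_zero.1 this with h3 | h3
      · exact h2' h3
      · have h4 := (hF j) (h3.trans (map_zero (F j)).symm)
        simp at h4
    refine ⟨(q₁ ⬝ᵥ x i)⁻¹ * (q₁ ⬝ᵥ z) * (q₂ ⬝ᵥ z)⁻¹ * (q₂ ⬝ᵥ x j), LinearMap.ext fun p => ?_⟩
    rw [LinearMap.smul_apply, mul_smul, e2, smul_smul, mul_assoc, inv_mul_cancel₀ hne, mul_one,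
      mul_smul, ← e1, smul_smul, inv_mul_cancel₀ h1', one_smul]
  let o : Fin n := ⟨0, by omega⟩
  have hprop' : ∀ i, ∃ c : K, F i = c • F o := fun i => by
    rcases eq_or_ne i o with rfl | hio
    · exact ⟨1, by simp⟩
    · exact hprop i o hio
  choose c hc using hprop'
  let P : Matrix (Fin n) (Fin n) K := LinearMap.toMatrix' (F o)
  let Q : Matrix (Fin n) (Fin n) K := Matrix.of fun k i => c i * x i k
  have hPQ : ∀ A, T A = P * A * Q := by
    intro A
    refine Matrix.ext_of_mulVec_single fun i => ?_
    have h1 : Q *ᵥ Pi.single i 1 = c i • x i := by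
      ext k; simp [Q]
    have h2 := hTv i A
    rw [evalAt_apply] at h2
    rw [h2, ← mulVec_mulVec, h1, ← mulVec_mulVec, hc i, mulVec_smul, mulVec_smul,
      LinearMap.toMatrix'_mulVec, LinearMap.smul_apply]
  -- Pairwise non-parallel columns do not make `Q` invertible; the invertibility of `T 1` does.
  have hu : IsUnit (P.det * Q.det) := by
    have := hPQ 1
    rw [mul_one] at this
    rw [← det_mul, ← this]
    exact (isUnit_iff_isUnit_det _).1 hT
  exact ⟨((isUnit_iff_isUnit_det P).2 (isUnit_of_mul_isUnit_left hu)).unit,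
    ((isUnit_iff_isUnit_det Q).2 (isUnit_of_mul_isUnit_right hu)).unit, hPQ⟩

/-- Adding the two types gives the map at `v + w`, which is zero or again of one type; each case
contradicts `not_forall_smul_add_smul_eq_smul`. -/
theorem not_factorsThroughEval_and_transpose (hn : 2 ≤ n)
    (hK : ∀ p : Polynomial K, p.degree = (n : WithBot ℕ) → ∃ x : K, p.IsRoot x)
    (T : Matrix (Fin n) (Fin n) K →ₗ[K] Matrix (Fin n) (Fin n) K)
    (hT : ∀ A, IsUnit A → ∀ v, v ≠ 0 → T A *ᵥ v ≠ 0) {v w : Fin n → K}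
    (hv : FactorsThroughEval (evalAt T v)) (hw : FactorsThroughEval (evalAt (compTranspose T) w)) :
    False := by
  obtain ⟨F, x, hF, hx, hFx⟩ := hv
  obtain ⟨G, y, hG, hy, hGy⟩ := hw
  have h1 : ∀ p q, T (vecMulVec p q) *ᵥ v = (q ⬝ᵥ x) • F p := by
    intro p q
    simpa [vecMulVec_mulVec] using hFx (vecMulVec p q)
  have h2 : ∀ p q, T (vecMulVec p q) *ᵥ w = (p ⬝ᵥ y) • G q := by
    intro p q
    simpa [vecMulVec_mulVec, transpose_vecMulVec] using hGy (vecMulVec q p)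
  by_cases hvw : v + w = 0
  · refine not_forall_smul_add_smul_eq_smul hn (H := 0) (x := x) (z := 0) hF hG hy fun p q => ?_
    rw [← h1, ← h2, ← mulVec_add, hvw]
    simp
  rcases factorsThroughEval_or_transpose hn hK (evalAt T (v + w))
    (fun A hA => hT A hA _ hvw) with ⟨H, z, -, -, hH⟩ | ⟨H, z, -, -, hH⟩
  · refine not_forall_smul_add_smul_eq_smul hn (H := H) (x := x) (z := z) hF hG hy fun p q => ?_
    rw [← h1, ← h2, ← mulVec_add]
    simpa [vecMulVec_mulVec] using hH (vecMulVec p q)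
  · refine not_forall_smul_add_smul_eq_smul hn (H := H) (x := y) (z := z) hG hF hx fun q p => ?_
    rw [add_comm, ← h1, ← h2, ← mulVec_add]
    simpa [vecMulVec_mulVec, transpose_vecMulVec] using hH (vecMulVec q p)

theorem exists_eq_mul_mul_or_transpose (hn : 2 ≤ n)
    (hK : ∀ p : Polynomial K, p.degree = (n : WithBot ℕ) → ∃ x : K, p.IsRoot x)
    (T : Matrix (Fin n) (Fin n) K →ₗ[K] Matrix (Fin n) (Fin n) K)
    (hT : ∀ A, IsUnit A → ∀ v, v ≠ 0 → T A *ᵥ v ≠ 0) :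
    (∃ P Q : GeneralLinearGroup (Fin n) K, ∀ A, T A = (P : Matrix (Fin n) (Fin n) K) * A *
      (Q : Matrix (Fin n) (Fin n) K)) ∨
    ∃ P Q : GeneralLinearGroup (Fin n) K, ∀ A, T A = (P : Matrix (Fin n) (Fin n) K) * Aᵀ *
      (Q : Matrix (Fin n) (Fin n) K) := by
  have hT1 : IsUnit (T 1) := by
    rw [← mulVec_injective_iff_isUnit]
    intro v w hvw
    by_contra hne
    exact hT 1 isUnit_one (v - w) (sub_ne_zero.2 hne) (by
      rw [mulVec_sub, sub_eq_zero]; exact hvw)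
  have hor : ∀ v, v ≠ 0 → FactorsThroughEval (evalAt T v) ∨
      FactorsThroughEval (evalAt (compTranspose T) v) := fun v hv =>
    factorsThroughEval_or_transpose hn hK (evalAt T v) fun A hA => hT A hA v hv
  by_cases h : ∀ v, v ≠ 0 → FactorsThroughEval (evalAt T v)
  · exact Or.inl (exists_eq_mul_mul_of_factorsThroughEval hn hK T hT1 h)
  · push Not at h
    obtain ⟨w, hw0, hw⟩ := h
    have hw' := (hor w hw0).resolve_left hw
    obtain ⟨P, Q, hPQ⟩ := exists_eq_mul_mul_of_factorsThroughEval hn hK (compTranspose T)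
      (by simpa using hT1) fun v hv => (hor v hv).resolve_left fun h =>
        not_factorsThroughEval_and_transpose hn hK T hT h hw'
    exact Or.inr ⟨P, Q, fun A => by simpa using hPQ Aᵀ⟩

end

/-! ### The span of the invertible matrices, and preservation of `H` -/

section
variable {K : Type*} [Field K] {n : ℕ}

theorem isUnit_one_add_vecMulVec {p q : Fin n → K} (h : 1 + q ⬝ᵥ p ≠ 0) :
    IsUnit (1 + vecMulVec p q) := by
  rw [← mulVec_injective_iff_isUnit]
  rw [← Matrix.coe_mulVecLin, ← LinearMap.ker_eq_bot, LinearMap.ker_eq_bot']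
  intro v hv
  have hv' : v + (q ⬝ᵥ v) • p = 0 := by
    simpa [add_mulVec, vecMulVec_mulVec] using hv
  have h1 := congrArg (q ⬝ᵥ ·) hv'
  simp only [dotProduct_add, dotProduct_smul, dotProduct_zero, smul_eq_mul] at h1
  have h2 : (1 + q ⬝ᵥ p) * (q ⬝ᵥ v) = 0 := by linear_combination h1
  have h3 := (mul_eq_zero.1 h2).resolve_left h
  simpa [h3] using hv'

theorem exists_ne_zero_ne_neg_one (hn : 2 ≤ n)
    (hK : ∀ p : Polynomial K, p.degree = (n : WithBot ℕ) → ∃ x : K, p.IsRoot x) :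
    ∃ c : K, c ≠ 0 ∧ 1 + c ≠ 0 := by
  by_cases h2 : (1 : K) + 1 = 0
  · obtain ⟨c, hc⟩ := hK (Polynomial.X ^ n + Polynomial.X + 1) (by
      rw [add_assoc, Polynomial.degree_add_eq_left_of_degree_lt, Polynomial.degree_X_pow]
      rw [Polynomial.degree_X_pow, ← Polynomial.C_1, Polynomial.degree_X_add_C]
      exact_mod_cast hn)
    have hc' : c ^ n + c + 1 = 0 := by simpa [Polynomial.IsRoot] using hc
    refine ⟨c, ?_, ?_⟩
    · rintro rfl
      simp [show n ≠ 0 by omega] at hc'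
    · intro h
      have h1 : c ^ n = 0 := by linear_combination hc' - h
      have h0 : c = 0 := pow_eq_zero_iff (by omega) |>.1 h1
      simp [h0] at h
  · exact ⟨1, one_ne_zero, h2⟩

/-- The invertible matrices span the space of all matrices. -/
theorem eq_top_of_forall_isUnit_mem (hn : 2 ≤ n)
    (hK : ∀ p : Polynomial K, p.degree = (n : WithBot ℕ) → ∃ x : K, p.IsRoot x)
    (S : Submodule K (Matrix (Fin n) (Fin n) K)) (hS : ∀ A, IsUnit A → A ∈ S) : S = ⊤ := by
  obtain ⟨c, hc, hc1⟩ := exists_ne_zero_ne_neg_one hn hK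
  have key : ∀ p q : Fin n → K, 1 + q ⬝ᵥ p ≠ 0 → vecMulVec p q ∈ S := fun p q h => by
    simpa using S.sub_mem (hS _ (isUnit_one_add_vecMulVec h)) (hS 1 isUnit_one)
  have hsm : ∀ p q : Fin n → K, vecMulVec p q ∈ S := by
    intro p q
    by_cases h : 1 + q ⬝ᵥ p = 0
    · have h1 : q ⬝ᵥ p = -1 := by linear_combination h
      -- Rescaling `p` by `-c` changes the dot product from `-1` to `c`, and `1 + c ≠ 0`.
      have := S.smul_mem (-c)⁻¹ (key ((-c) • p) q (by simpa [h1] using hc1))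
      rwa [smul_vecMulVec, smul_smul, inv_mul_cancel₀ (neg_ne_zero.2 hc), one_smul] at this
    · exact key p q h
  have : S.mkQ = 0 := linearMap_ext_vecMulVec fun p q => by simpa using hsm p q
  rw [← S.ker_mkQ, this, LinearMap.ker_zero]

theorem greenRel_H_of_isUnit {A B : Matrix (Fin n) (Fin n) K} (hA : IsUnit A) (hB : IsUnit B) :
    GreenRel.H A B := by
  obtain ⟨u, rfl⟩ := hA
  obtain ⟨v, rfl⟩ := hB
  exact ⟨⟨⟨↑(v⁻¹ * u), by simp⟩, ⟨↑(u⁻¹ * v), by simp⟩⟩,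
    ⟨⟨↑(u * v⁻¹), by simp⟩, ⟨↑(v * u⁻¹), by simp⟩⟩⟩

theorem preservesRel_H_mul_mul (P Q : GeneralLinearGroup (Fin n) K) :
    PreservesRel (GreenRel.H (M := Matrix (Fin n) (Fin n) K))
      fun A => (P : Matrix (Fin n) (Fin n) K) * A * (Q : Matrix (Fin n) (Fin n) K) := by
  have hr : ∀ a s : Matrix (Fin n) (Fin n) K, (P : Matrix (Fin n) (Fin n) K) * (a * s) * Q =
      P * a * Q * ((Q⁻¹ : GeneralLinearGroup (Fin n) K) * s * Q) := by
    intro a s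
    simp only [mul_assoc, Units.mul_inv_cancel_left]
  have hl : ∀ a s : Matrix (Fin n) (Fin n) K, (P : Matrix (Fin n) (Fin n) K) * (s * a) * Q =
      (P * s * (P⁻¹ : GeneralLinearGroup (Fin n) K)) * (P * a * Q) := by
    intro a s
    simp only [mul_assoc, Units.inv_mul_cancel_left]
  rintro a b ⟨⟨⟨s₁, h₁⟩, ⟨s₂, h₂⟩⟩, ⟨⟨s₃, h₃⟩, ⟨s₄, h₄⟩⟩⟩
  exact ⟨⟨⟨_, (congrArg (fun A => P.1 * A * Q.1) h₁).trans (hr _ _)⟩,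
      ⟨_, (congrArg (fun A => P.1 * A * Q.1) h₂).trans (hr _ _)⟩⟩,
    ⟨⟨_, (congrArg (fun A => P.1 * A * Q.1) h₃).trans (hl _ _)⟩,
      ⟨_, (congrArg (fun A => P.1 * A * Q.1) h₄).trans (hl _ _)⟩⟩⟩

theorem preservesRel_H_transpose :
    PreservesRel (GreenRel.H (M := Matrix (Fin n) (Fin n) K)) Matrix.transpose := by
  rintro a b ⟨⟨⟨s₁, h₁⟩, ⟨s₂, h₂⟩⟩, ⟨⟨s₃, h₃⟩, ⟨s₄, h₄⟩⟩⟩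
  exact ⟨⟨⟨s₃ᵀ, (congrArg _ h₃).trans (transpose_mul _ _)⟩,
      ⟨s₄ᵀ, (congrArg _ h₄).trans (transpose_mul _ _)⟩⟩,
    ⟨⟨s₁ᵀ, (congrArg _ h₁).trans (transpose_mul _ _)⟩,
      ⟨s₂ᵀ, (congrArg _ h₂).trans (transpose_mul _ _)⟩⟩⟩

theorem eq_zero_or_forall_mulVec_ne_zero (hn : 2 ≤ n)
    (hK : ∀ p : Polynomial K, p.degree = (n : WithBot ℕ) → ∃ x : K, p.IsRoot x)
    (T : Matrix (Fin n) (Fin n) K →ₗ[K] Matrix (Fin n) (Fin n) K)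
    (hT : PreservesRel (GreenRel.H (M := Matrix (Fin n) (Fin n) K)) T) :
    T = 0 ∨ ∀ A, IsUnit A → ∀ v, v ≠ 0 → T A *ᵥ v ≠ 0 := by
  have hH : ∀ A, IsUnit A → GreenRel.H (T A) (T 1) :=
    fun A hA => hT _ _ (greenRel_H_of_isUnit hA isUnit_one)
  have hker : ∀ A, IsUnit A → ∀ v, T 1 *ᵥ v ≠ 0 → T A *ᵥ v ≠ 0 := by
    intro A hA v hv h0
    obtain ⟨-, -, ⟨s, hs⟩⟩ := hH A hA
    exact hv (by rw [hs, ← mulVec_mulVec, h0, mulVec_zero])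
  have hrange : ∀ A, ∃ s, T 1 * s = T A := by
    have h := eq_top_of_forall_isUnit_mem hn hK
      ((LinearMap.range (LinearMap.mulLeft K (T 1))).comap T) fun A hA => by
        obtain ⟨⟨⟨s, hs⟩, -⟩, -⟩ := hH A hA
        exact ⟨s, hs.symm⟩
    intro A
    have hA : A ∈ (LinearMap.range (LinearMap.mulLeft K (T 1))).comap T := h ▸ Submodule.mem_top
    exact hA
  by_cases h1 : T 1 = 0
  · left
    ext1 A
    obtain ⟨s, hs⟩ := hrange A
    simp [← hs, h1]
  right
  obtain ⟨v, hv⟩ : ∃ v, T 1 *ᵥ v ≠ 0 := by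
    by_contra! hcon
    exact h1 (Matrix.ext_of_mulVec_single fun i => by simp only [hcon, zero_mulVec])
  have hsurj : Function.Surjective (evalAt T v) := by
    have hev : ∀ (F : (Fin n → K) →ₗ[K] (Fin n → K)) (x : Fin n → K), Function.Injective F →
        x ≠ 0 → ∀ y, ∃ A : Matrix (Fin n) (Fin n) K, F (A *ᵥ x) = y := by
      intro F x hF hx y
      obtain ⟨z, rfl⟩ := LinearMap.injective_iff_surjective.1 hF y
      obtain ⟨q, hq⟩ := exists_dotProduct_ne_zero hx
      refine ⟨vecMulVec ((q ⬝ᵥ x)⁻¹ • z) q, ?_⟩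
      simp [smul_mulVec, vecMulVec_mulVec, smul_smul, inv_mul_cancel₀ hq]
    intro y
    rcases factorsThroughEval_or_transpose hn hK (evalAt T v) (fun A hA => hker A hA v hv) with
      ⟨F, x, hF, hx, h⟩ | ⟨F, x, hF, hx, h⟩
    · obtain ⟨A, hA⟩ := hev F x hF hx y
      exact ⟨A, (h A).trans hA⟩
    · obtain ⟨A, hA⟩ := hev F x hF hx y
      exact ⟨Aᵀ, (h A).trans hA⟩
  -- Every vector is some `T A *ᵥ v`, hence lies in the range of `T 1`.
  have hinj : Function.Injective (T 1).mulVecLin := by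
    rw [LinearMap.injective_iff_surjective]
    intro y
    obtain ⟨A, hA⟩ := hsurj y
    obtain ⟨s, hs⟩ := hrange A
    exact ⟨s *ᵥ v, by rw [← hA, evalAt_apply, ← hs, mulVecLin_apply, mulVec_mulVec]⟩
  exact fun A hA w hw => hker A hA w fun h0 => hw (hinj (by simpa using h0))

theorem exists_eq_smul_one_of_le_one (hn : n ≤ 1) (A : Matrix (Fin n) (Fin n) K) :
    ∃ c : K, A = c • 1 := by
  have : Subsingleton (Fin n) := Fin.subsingleton_iff_le_one.2 hn
  obtain _ | ⟨⟨i⟩⟩ := isEmpty_or_nonempty (Fin n)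
  · exact ⟨0, Subsingleton.elim _ _⟩
  · refine ⟨A i i, ?_⟩
    ext k l
    obtain rfl := Subsingleton.elim k i
    obtain rfl := Subsingleton.elim l k
    simp

end

/-! ### The classification, with `n ≤ 1` treated by scalar matrices -/

theorem mainTheorem7 {K : Type*} [Field K] (n : ℕ)
    (hK : ∀ p : Polynomial K, p.degree = (n : WithBot ℕ) → ∃ x : K, p.IsRoot x)
    (T : Matrix (Fin n) (Fin n) K →ₗ[K] Matrix (Fin n) (Fin n) K) :
    PreservesRel (GreenRel.H (M := Matrix (Fin n) (Fin n) K)) T ↔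
      (T = 0 ∨
        (∃ P Q : Matrix.GeneralLinearGroup (Fin n) K, ∀ A : Matrix (Fin n) (Fin n) K,
          T A = (P : Matrix (Fin n) (Fin n) K) * A * (Q : Matrix (Fin n) (Fin n) K)) ∨
        (∃ P Q : Matrix.GeneralLinearGroup (Fin n) K, ∀ A : Matrix (Fin n) (Fin n) K,
          T A = (P : Matrix (Fin n) (Fin n) K) * A.transpose *
            (Q : Matrix (Fin n) (Fin n) K))) := by
  constructor
  · intro hT
    by_cases hn : 2 ≤ n
    · exact (eq_zero_or_forall_mulVec_ne_zero hn hK T hT).imp_right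
        (exists_eq_mul_mul_or_transpose hn hK T)
    have hsc := exists_eq_smul_one_of_le_one (K := K) (n := n) (by omega)
    by_cases h1 : T 1 = 0
    · left
      ext1 A
      obtain ⟨c, rfl⟩ := hsc A
      simp [h1]
    · right; left
      have hu : IsUnit (T 1) := by
        obtain ⟨c, hc⟩ := hsc (T 1)
        have hc0 : c ≠ 0 := by rintro rfl; exact h1 (by simpa using hc)
        rw [hc]
        exact (isUnit_one).smul (Units.mk0 c hc0)
      refine ⟨hu.unit, 1, fun A => ?_⟩
      obtain ⟨c, rfl⟩ := hsc A
      simp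
  · rintro (rfl | ⟨P, Q, h⟩ | ⟨P, Q, h⟩)
    · intro a b _
      exact ⟨⟨⟨0, by simp⟩, ⟨0, by simp⟩⟩, ⟨⟨0, by simp⟩, ⟨0, by simp⟩⟩⟩
    · intro a b hab
      rw [h, h]
      exact preservesRel_H_mul_mul P Q a b hab
    · intro a b hab
      rw [h, h]
      exact preservesRel_H_mul_mul P Q _ _ (preservesRel_H_transpose a b hab)
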